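/- Let $(\mathcal X,d)$ be a compact metric space with at least two points, $D_{\mathcal X}>0$ its diameter, $(x_n)_{n\in\mathbb N}$ a dense sequence in $\mathcal X$, $q>1$ and $N\ge 2$. Put $c=\sqrt{q^2-1}/q$ and $$\varphi(x)=\Big(\frac{c\,d(x,x_n)}{q^n}\Big)_{n\ge 0}\in\ell^2,\qquad \varphi_t(x)=\Big(\frac{c\,d(x,x_n)}{q^n}\Big)_{0\le n\le N-1}\in\mathbb R^N,$$ let $B_t:\mathbb R^N\to\ell^2$ be padding by zeros, and let $W=\varphi(\mathcal X)\cup B_t(\varphi_t(\mathcal X))\subset\ell^2$. Let $k_W:W^2\to\mathbb R$ be of one of the following two types. (Taylor) $k_W(u,v)=K(\langle u,v\rangle_{\ell^2})$ with $K(t)=\sum_{n\ge0}a_nt^n$, where all $a_n>0$, the series converges absolutely on $I=[-4D_{\mathcal X}^2,4D_{\mathcal X}^2]$ and $K$ is continuously differentiable on $I$. (Radial) $k_W(u,v)=K(\|u-v\|_{\ell^2}^2)$ with $K(t)=\int_{[0,\infty)}e^{-st}\,d\mu(s)$, where $\mu$ is a nonzero finite Borel measure on $[0,\infty)$ with $\operatorname{supp}\mu\neq\{0\}$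 and $K$ is continuously differentiable on $I=[0,4D_{\mathcal X}^2]$. In both cases derivatives at endpoints of $I$ are one-sided, and $C_{K'}=\max_{t\in I}|K'(t)|$. Put $$k(x,y)=k_W(\varphi(x),\varphi(y)),\qquad k_t(x,y)=k_W(B_t\varphi_t(x),B_t\varphi_t(y)).$$ Then $k$ and $k_t$ are kernels (symmetric and positive semidefinite) on $\mathcal X$. Let $H$ and $H_t$ be their reproducing kernel Hilbert spaces. For every $\varepsilon>0$ and $f\in C(\mathcal X)$ there is a unique $h[\varepsilon,f]\in H$ that minimises $\|h\|_H^2$ among all $h\in H$ with $\|h-f\|_\infty\le\varepsilon$, and there is $h_t\in H_t$ such that $$\|f-h_t\|_\infty\le\varepsilon+\rho_t\,\|h[\varepsilon,f]\|_H,$$ where $\rho_t=q^{-N/2}D_{\mathcal X}\sqrt{2C_{K'}}$ in the Taylor case and $\rho_t=q^{-N}D_{\mathcal X}\sqrt{2C_{K'}}$ in the radial case. -/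

import Mathlib

open scoped lp NNReal InnerProductSpace

noncomputable section

namespace TruncatedKernel

/-! ### Kernels and their reproducing kernel Hilbert spaces -/

/-- A kernel on a set: a symmetric real function all of whose finite quadratic forms are
nonnegative. -/
def IsKernel {X : Type*} (k : X → X → ℝ) : Prop :=
  (∀ x y, k x y = k y x) ∧
    ∀ (n : ℕ) (x : Fin n → X) (a : Fin n → ℝ), 0 ≤ ∑ i, ∑ j, a i * k (x i) (x j) * a j

/-- A scalar kernel as a matrix of operators on `ℝ`, the format of Mathlib's `RKHS`. -/
def kernelMatrix {X : Type*} (k : X → X → ℝ) : Matrix X X (ℝ →L[ℝ] ℝ) :=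
  Matrix.of fun x y => k x y • ContinuousLinearMap.id ℝ ℝ

theorem IsKernel.posSemidef {X : Type*} {k : X → X → ℝ} (hk : IsKernel k) :
    (kernelMatrix k).PosSemidef := by
  have h := (RKHS.posSemidef_tfae (𝕜 := ℝ) (K := kernelMatrix k)).out 0 2
  refine h.mpr ⟨?_, fun v => ?_⟩
  · ext x y
    have h1 : star (ContinuousLinearMap.id ℝ ℝ) = ContinuousLinearMap.id ℝ ℝ :=
      star_one (ℝ →L[ℝ] ℝ)
    simp [kernelMatrix, Matrix.conjTranspose_apply, hk.1 y x, h1]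
  · have key := hk.2 v.support.card (fun i => (v.support.equivFin.symm i : X))
      (fun i => v (v.support.equivFin.symm i))
    have e : ∀ g : X → ℝ,
        ∑ i, g (v.support.equivFin.symm i : X) = ∑ x ∈ v.support, g x := by
      intro g
      rw [Equiv.sum_comp v.support.equivFin.symm (fun z : v.support => g z)]
      exact Finset.sum_coe_sort v.support g
    simp only [Finsupp.sum, kernelMatrix]
    refine key.trans (le_of_eq ?_)
    rw [e (fun z => ∑ j, v z * k z (v.support.equivFin.symm j : X) *
      v (v.support.equivFin.symm j : X))]
    simp only [map_sum, RCLike.re_to_real]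
    refine Finset.sum_congr rfl fun z _ => (e (fun w => v z * k z w * v w)).trans ?_
    refine Finset.sum_congr rfl fun w _ => ?_
    simp [hk.1 z w]
    ring

/-- The reproducing kernel Hilbert space of a kernel. -/
abbrev RKHSpace {X : Type*} {k : X → X → ℝ} (hk : IsKernel k) : Type _ :=
  @RKHS.OfKernel ℝ _ X ℝ _ _ _ (kernelMatrix k) ⟨hk.posSemidef⟩

/-! ### Taylor and radial kernels on subsets of `ℓ²` -/

/-- `K(t) = ∑ aₙ tⁿ`. -/
def taylorFun (a : ℕ → ℝ) (t : ℝ) : ℝ := ∑' n, a n * t ^ n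

/-- Positive coefficients of a power series that converges absolutely on `[-r, r]`. -/
structure IsTaylorCoeff (a : ℕ → ℝ) (r : ℝ) : Prop where
  pos : ∀ n, 0 < a n
  summable : ∀ t ∈ Set.Icc (-r) r, Summable fun n => |a n * t ^ n|

/-- The Taylor kernel `K(⟨u, v⟩)` on `W`. -/
def taylorKernel (a : ℕ → ℝ) (W : Set ℓ²(ℕ, ℝ)) (u v : W) : ℝ :=
  taylorFun a ⟪(u : ℓ²(ℕ, ℝ)), (v : ℓ²(ℕ, ℝ))⟫_ℝ

/-- `K(t) = ∫ exp (-s t) dμ(s)`, for a measure `μ` on `[0, ∞)`. -/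
def radialFun (μ : MeasureTheory.Measure ℝ≥0) (t : ℝ) : ℝ :=
  ∫ s, Real.exp (-(s : ℝ) * t) ∂μ

/-- The radial kernel `K(‖u - v‖²)` on `W`. -/
def radialKernel (μ : MeasureTheory.Measure ℝ≥0) (W : Set ℓ²(ℕ, ℝ)) (u v : W) : ℝ :=
  radialFun μ (‖(u : ℓ²(ℕ, ℝ)) - (v : ℓ²(ℕ, ℝ))‖ ^ 2)

/-- `max_{t ∈ I} |K'(t)|`, with one-sided derivatives at the endpoints of the interval `I`. -/
def maxAbsDeriv (K : ℝ → ℝ) (I : Set ℝ) : ℝ :=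
  sSup ((fun t => |derivWithin K I t|) '' I)

/-! ### The embedding, its truncation, and the induced kernels -/

section Embedding

variable {X : Type*} [MetricSpace X]

/-- The diameter of the whole space. -/
def diamX (X : Type*) [MetricSpace X] : ℝ := Metric.diam (Set.univ : Set X)

/-- The normalising constant `√(q² - 1) / q`. -/
def cPhi (q : ℝ) : ℝ := √(q ^ 2 - 1) / q

theorem memℓp_phi [CompactSpace X] (x : ℕ → X) {q : ℝ} (hq : 1 < q) (p : X) :
    Memℓp (fun n => cPhi q * dist p (x n) / q ^ n) 2 := by
  refine memℓp_gen ?_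
  have hq0 : (0 : ℝ) < q := by linarith
  have hs : Summable fun n : ℕ => (|cPhi q| * diamX X) ^ 2 * ((q ^ 2)⁻¹) ^ n := by
    refine (summable_geometric_of_lt_one (by positivity) ?_).mul_left _
    exact inv_lt_one_of_one_lt₀ (one_lt_pow₀ hq two_ne_zero)
  refine Summable.of_nonneg_of_le (fun n => by positivity) (fun n => ?_) hs
  have hd : dist p (x n) ≤ diamX X :=
    Metric.dist_le_diam_of_mem isCompact_univ.isBounded (Set.mem_univ _) (Set.mem_univ _)
  have h1 : ‖cPhi q * dist p (x n) / q ^ n‖ ≤ |cPhi q| * diamX X / q ^ n := by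
    rw [Real.norm_eq_abs, abs_div, abs_mul, abs_of_nonneg (dist_nonneg),
      abs_of_pos (pow_pos hq0 n)]
    gcongr
  have h2 : (|cPhi q| * diamX X) ^ 2 * ((q ^ 2)⁻¹) ^ n = (|cPhi q| * diamX X / q ^ n) ^ 2 := by
    rw [div_pow, inv_pow, div_eq_mul_inv, ← pow_mul, ← pow_mul, mul_comm 2 n]
  rw [h2]
  simpa using pow_le_pow_left₀ (norm_nonneg _) h1 2

/-- The embedding `φ(p) = (c d(p, xₙ) / qⁿ)ₙ` into `ℓ²`. -/
def phi [CompactSpace X] (x : ℕ → X) {q : ℝ} (hq : 1 < q) (p : X) : ℓ²(ℕ, ℝ) :=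
  ⟨fun n => cPhi q * dist p (x n) / q ^ n, memℓp_phi x hq p⟩

/-- The truncation of `φ` to its first `N` coordinates. -/
def phiTrunc (x : ℕ → X) (q : ℝ) (N : ℕ) (p : X) : EuclideanSpace ℝ (Fin N) :=
  WithLp.toLp 2 fun n => cPhi q * dist p (x n) / q ^ (n : ℕ)

theorem memℓp_pad {N : ℕ} (u : EuclideanSpace ℝ (Fin N)) :
    Memℓp (fun n : ℕ => if h : n < N then u ⟨n, h⟩ else 0) 2 := by
  refine (memℓp_zero ?_).of_exponent_ge bot_le
  refine (Set.finite_lt_nat N).subset fun n hn => ?_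
  by_contra h
  simp only [Set.mem_ofPred_eq] at h hn
  exact hn (dif_neg h)

/-- Padding by zeros, `(u₀, …, u_{N-1}) ↦ (u₀, …, u_{N-1}, 0, 0, …)`. -/
def pad {N : ℕ} (u : EuclideanSpace ℝ (Fin N)) : ℓ²(ℕ, ℝ) :=
  ⟨fun n : ℕ => if h : n < N then u ⟨n, h⟩ else 0, memℓp_pad u⟩

variable [CompactSpace X]

/-- The set `W = φ(X) ∪ B_t(φ_t(X))`. -/
def wSet (x : ℕ → X) {q : ℝ} (hq : 1 < q) (N : ℕ) : Set ℓ²(ℕ, ℝ) :=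
  Set.range (phi x hq) ∪ Set.range fun p => pad (phiTrunc x q N p)

/-- `k(p, p') = k_W(φ(p), φ(p'))`. -/
def fullKernel (x : ℕ → X) {q : ℝ} (hq : 1 < q) (N : ℕ)
    (kW : wSet x hq N → wSet x hq N → ℝ) (p p' : X) : ℝ :=
  kW ⟨phi x hq p, Or.inl ⟨p, rfl⟩⟩ ⟨phi x hq p', Or.inl ⟨p', rfl⟩⟩

/-- `k_t(p, p') = k_W(B_t(φ_t(p)), B_t(φ_t(p')))`. -/
def truncKernel (x : ℕ → X) {q : ℝ} (hq : 1 < q) (N : ℕ)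
    (kW : wSet x hq N → wSet x hq N → ℝ) (p p' : X) : ℝ :=
  kW ⟨pad (phiTrunc x q N p), Or.inr ⟨p, rfl⟩⟩ ⟨pad (phiTrunc x q N p'), Or.inr ⟨p', rfl⟩⟩

end Embedding

/-! ### Least-norm approximation and the approximation property -/

/-- `h` is a minimiser of `‖h‖²_H` over all `h ∈ H` with `‖h - f‖_∞ ≤ ε`. -/
def IsLeastNormApprox {X : Type*} [TopologicalSpace X] {k : X → X → ℝ} (hk : IsKernel k)
    (ε : ℝ) (f : C(X, ℝ)) (h : RKHSpace hk) : Prop :=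
  (∀ p, |h p - f p| ≤ ε) ∧
    ∀ g : RKHSpace hk, (∀ p, |g p - f p| ≤ ε) → ‖h‖ ^ 2 ≤ ‖g‖ ^ 2

/-- For the kernels `k` and `k_t` with reproducing kernel Hilbert spaces `H` and `H_t`: for all
`ε > 0` and continuous `f`, the element `h[ε, f]` of `H` is well defined, and some `h_t ∈ H_t`
satisfies `‖f - h_t‖_∞ ≤ ε + ρ ‖h[ε, f]‖_H`. -/
def ApproximatesUpTo {X : Type*} [TopologicalSpace X] {k kt : X → X → ℝ} (hk : IsKernel k)
    (hkt : IsKernel kt) (ρ : ℝ) : Prop :=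
  ∀ ε : ℝ, 0 < ε → ∀ f : C(X, ℝ),
    (∃! h : RKHSpace hk, IsLeastNormApprox hk ε f h) ∧
      ∀ h : RKHSpace hk, IsLeastNormApprox hk ε f h →
        ∃ ht : RKHSpace hkt, ∀ p, |f p - ht p| ≤ ε + ρ * ‖h‖

end TruncatedKernel

end

open TruncatedKernel

namespace TruncatedKernel

/-! ### Operations on kernels -/

section Kernels

variable {X : Type*} {k l : X → X → ℝ}

/-! Two facts carry the theorem: `H` is uniformly dense in `C(X)`, and `φ` is close to its
truncation in the feature space of `k_W`.

Density. If `k - c f ⊗ f` is a kernel with `c > 0`, then `f ∈ H` (`exists_eq_of_isKernel_sub`). By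
Bessel and the Schur product theorem, `⟪φ, φ⟫ ^ m - f ⊗ f` is a kernel for each monomial `f` of
degree `m` in the coordinates of `φ` (`exists_isKernel_inner_pow_sub`). In the Taylor case `a m > 0`
puts every monomial into `H`. In the radial case, factoring the Gaussian as `exp (-s‖u‖²) exp
(-s‖v‖²) exp (2s⟪u, v⟫)` and integrating over `s ≥ s₀ > 0` puts every monomial times one fixed
positive weight into `H`. The coordinates separate points because `(xₙ)` is dense, so
Stone–Weierstrass applies (`exists_near_of_monomials`). The feasible set is then nonempty, closed
and convex, and has a unique point of least norm.

Transfer. With `Φ` the feature map of `k_W`, represent `h` as `⟪w, Φ (φ p)⟫` with `‖w‖ ≤ ‖h‖` and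
take `h_t p = ⟪w, Φ (B_t φ_t p)⟫` (`exists_transfer`). For `u = φ p` and `v = B_t φ_t p` the error
is at most `‖h‖ ‖Φ u - Φ v‖`, and `‖Φ u - Φ v‖² = k_W(u,u) - 2 k_W(u,v) + k_W(v,v)` is bounded by
the mean value inequality and `‖u - v‖ ≤ D q⁻ᴺ`. -/

theorem IsKernel.add (hk : IsKernel k) (hl : IsKernel l) :
    IsKernel fun x y => k x y + l x y := by
  refine ⟨fun x y => by simp only [hk.1 x y, hl.1 x y], fun n x a => ?_⟩
  refine (add_nonneg (hk.2 n x a) (hl.2 n x a)).trans_eq ?_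
  simp only [← Finset.sum_add_distrib]
  exact Finset.sum_congr rfl fun i _ => Finset.sum_congr rfl fun j _ => by ring

theorem IsKernel.const_mul (hk : IsKernel k) {c : ℝ} (hc : 0 ≤ c) :
    IsKernel fun x y => c * k x y := by
  refine ⟨fun x y => by simp only [hk.1 x y], fun n x a => ?_⟩
  refine (mul_nonneg hc (hk.2 n x a)).trans_eq ?_
  simp only [Finset.mul_sum]
  exact Finset.sum_congr rfl fun i _ => Finset.sum_congr rfl fun j _ => by ring

theorem IsKernel.comp {Y : Type*} (hk : IsKernel k) (g : Y → X) :
    IsKernel fun x y => k (g x) (g y) :=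
  ⟨fun _ _ => hk.1 _ _, fun n x a => hk.2 n (g ∘ x) a⟩

theorem IsKernel.of_hasSum {g : ℕ → X → X → ℝ} (hg : ∀ n, IsKernel (g n))
    (h : ∀ x y, HasSum (fun n => g n x y) (k x y)) : IsKernel k := by
  refine ⟨fun x y => ?_, fun n x a => ?_⟩
  · have h1 := h y x
    simp only [(hg _).1 y x] at h1
    exact (h x y).unique h1
  · have h1 : HasSum (fun m => ∑ i, ∑ j, a i * g m (x i) (x j) * a j)
        (∑ i, ∑ j, a i * k (x i) (x j) * a j) :=
      hasSum_sum fun i _ => hasSum_sum fun j _ => ((h _ _).mul_left _).mul_right _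
    exact h1.nonneg fun m => (hg m).2 n x a

/-- The Schur product theorem, applied to the matrices of kernel values at finitely many points. -/
theorem IsKernel.mul (hk : IsKernel k) (hl : IsKernel l) :
    IsKernel fun x y => k x y * l x y := by
  have aux : ∀ {k : X → X → ℝ}, IsKernel k → ∀ (n : ℕ) (x : Fin n → X),
      (Matrix.of fun i j => k (x i) (x j)).PosSemidef := by
    intro k hk n x
    rw [Matrix.posSemidef_iff_dotProduct_mulVec]
    refine ⟨by ext i j; simp [hk.1 (x i) (x j)], fun a => ?_⟩
    refine (hk.2 n x a).trans_eq ?_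
    simp [dotProduct, Matrix.mulVec, Finset.mul_sum, mul_assoc]
  refine ⟨fun x y => by simp only [hk.1 x y, hl.1 x y], fun n x a => ?_⟩
  have h := (aux hk n x).hadamard (aux hl n x)
  rw [Matrix.posSemidef_iff_dotProduct_mulVec] at h
  refine (h.2 a).trans_eq ?_
  simp [dotProduct, Matrix.mulVec, Finset.mul_sum, mul_assoc]

theorem isKernel_mul_self (f : X → ℝ) : IsKernel fun x y => f x * f y := by
  refine ⟨fun x y => mul_comm _ _, fun n x a => ?_⟩
  refine (mul_self_nonneg (∑ i, a i * f (x i))).trans_eq ?_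
  rw [Finset.sum_mul_sum]
  exact Finset.sum_congr rfl fun i _ => Finset.sum_congr rfl fun j _ => by ring

theorem IsKernel.pow (hk : IsKernel k) (n : ℕ) : IsKernel fun x y => k x y ^ n := by
  induction n with
  | zero => simpa using isKernel_mul_self fun _ : X => (1 : ℝ)
  | succ n ih => simpa only [pow_succ] using ih.mul hk

variable {E : Type*} [NormedAddCommGroup E] [InnerProductSpace ℝ E]

theorem sum_sum_inner (Φ : X → E) {n : ℕ} (x : Fin n → X) (a : Fin n → ℝ) :
    ∑ i, ∑ j, a i * ⟪Φ (x i), Φ (x j)⟫_ℝ * a j = ‖∑ i, a i • Φ (x i)‖ ^ 2 := by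
  rw [← real_inner_self_eq_norm_sq, sum_inner]
  simp only [inner_sum, real_inner_smul_left, real_inner_smul_right]
  exact Finset.sum_congr rfl fun i _ => Finset.sum_congr rfl fun j _ => by ring

theorem isKernel_inner (Φ : X → E) : IsKernel fun x y => ⟪Φ x, Φ y⟫_ℝ :=
  ⟨fun x y => real_inner_comm _ _, fun n x a => by rw [sum_sum_inner]; positivity⟩

end Kernels

/-! ### Interpolation in Hilbert spaces and membership in the reproducing kernel Hilbert space -/

section Membership

variable {X : Type*} {E : Type*} [NormedAddCommGroup E] [InnerProductSpace ℝ E]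

theorem sum_equivFin_symm {M : Type*} [AddCommMonoid M] (s : Finset X) (g : X → M) :
    ∑ i, g (s.equivFin.symm i : X) = ∑ x ∈ s, g x := by
  rw [Equiv.sum_comp s.equivFin.symm (fun z : s => g z)]
  exact Finset.sum_coe_sort s g

theorem abs_sum_mul_inner_le (w : E) (Φ : X → E) {n : ℕ} (x : Fin n → X) (a : Fin n → ℝ) :
    |∑ i, a i * ⟪w, Φ (x i)⟫_ℝ| ≤ ‖w‖ * ‖∑ i, a i • Φ (x i)‖ := by
  have : ∑ i, a i * ⟪w, Φ (x i)⟫_ℝ = ⟪w, ∑ i, a i • Φ (x i)⟫_ℝ := by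
    simp [inner_sum, real_inner_smul_right]
  rw [this]
  exact abs_real_inner_le_norm _ _

/-- A function on `X` that is bounded with respect to the feature map `Φ` is represented by a
vector of the Hilbert space. -/
theorem exists_inner_eq_of_abs_sum_le [CompleteSpace E] (Φ : X → E) (f : X → ℝ) {C : ℝ}
    (hC : 0 ≤ C) (h : ∀ (n : ℕ) (x : Fin n → X) (a : Fin n → ℝ),
      |∑ i, a i * f (x i)| ≤ C * ‖∑ i, a i • Φ (x i)‖) :
    ∃ w : E, ‖w‖ ≤ C ∧ ∀ x, ⟪w, Φ x⟫_ℝ = f x := by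
  let T : (X →₀ ℝ) →ₗ[ℝ] E := Finsupp.linearCombination ℝ Φ
  let F : (X →₀ ℝ) →ₗ[ℝ] ℝ := Finsupp.linearCombination ℝ f
  have hF : ∀ v, |F v| ≤ C * ‖T v‖ := by
    intro v
    have h1 := h v.support.card (fun i => (v.support.equivFin.symm i : X))
      (fun i => v (v.support.equivFin.symm i))
    rw [sum_equivFin_symm _ fun z => v z * f z, sum_equivFin_symm _ fun z => v z • Φ z] at h1
    simpa only [F, T, Finsupp.linearCombination_apply, Finsupp.sum, smul_eq_mul] using h1
  -- The bound makes `F` vanish where `T` does, so `F` descends to a bounded functional on the range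
  -- of `T`. Hahn–Banach extends it to `E` with the same norm, and Riesz gives the vector.
  have hker : LinearMap.ker T ≤ LinearMap.ker F := by
    intro v hv
    have := hF v
    rw [LinearMap.mem_ker.mp hv, norm_zero, mul_zero] at this
    exact LinearMap.mem_ker.mpr (abs_nonpos_iff.mp this)
  let G : LinearMap.range T →ₗ[ℝ] ℝ :=
    (LinearMap.ker T).liftQ F hker ∘ₗ T.quotKerEquivRange.symm.toLinearMap
  have hG : ∀ v, G ⟨T v, v, rfl⟩ = F v := by
    intro v
    have : T.quotKerEquivRange.symm ⟨T v, v, rfl⟩ = (LinearMap.ker T).mkQ v := by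
      rw [LinearEquiv.symm_apply_eq]
      rfl
    simp [G, this]
  have hGC : ∀ z, ‖G z‖ ≤ C * ‖z‖ := by
    rintro ⟨_, v, rfl⟩
    rw [hG]
    exact hF v
  obtain ⟨g, hg, hgn⟩ := exists_extension_norm_eq (𝕜 := ℝ) (LinearMap.range T)
    (G.mkContinuous C hGC)
  refine ⟨(InnerProductSpace.toDual ℝ E).symm g, ?_, fun x => ?_⟩
  · rw [LinearIsometryEquiv.norm_map, hgn]
    exact G.mkContinuous_norm_le hC hGC
  · rw [InnerProductSpace.toDual_symm_apply]
    have h1 : T (Finsupp.single x 1) = Φ x := by simp [T]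
    have h2 := hg ⟨T (Finsupp.single x 1), _, rfl⟩
    rw [LinearMap.mkContinuous_apply, hG] at h2
    simpa [h1, F] using h2

variable {k : X → X → ℝ}

/-- The kernel section `k(·, x)` as an element of the reproducing kernel Hilbert space. -/
noncomputable def kernelSection (hk : IsKernel k) (x : X) : RKHSpace hk :=
  haveI : Fact (kernelMatrix k).PosSemidef := ⟨hk.posSemidef⟩
  RKHS.kerFun (RKHSpace hk) x (1 : ℝ)

theorem inner_kernelSection (hk : IsKernel k) (h : RKHSpace hk) (x : X) :
    ⟪h, kernelSection hk x⟫_ℝ = h x := by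
  have : Fact (kernelMatrix k).PosSemidef := ⟨hk.posSemidef⟩
  simp [kernelSection]

theorem inner_kernelSection_kernelSection (hk : IsKernel k) (x y : X) :
    ⟪kernelSection hk x, kernelSection hk y⟫_ℝ = k x y := by
  have : Fact (kernelMatrix k).PosSemidef := ⟨hk.posSemidef⟩
  rw [inner_kernelSection, kernelSection, RKHS.kerFun_apply, RKHS.OfKernel.kernel_ofKernel]
  simp [kernelMatrix, hk.1 x y]

theorem norm_sum_kernelSection_sq (hk : IsKernel k) {n : ℕ} (x : Fin n → X) (a : Fin n → ℝ) :
    ‖∑ i, a i • kernelSection hk (x i)‖ ^ 2 = ∑ i, ∑ j, a i * k (x i) (x j) * a j := by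
  rw [← sum_sum_inner]
  simp only [inner_kernelSection_kernelSection]

/-- If `k - c f ⊗ f` is a kernel for some `c > 0`, then `f` lies in the reproducing kernel
Hilbert space of `k`. -/
theorem exists_eq_of_isKernel_sub (hk : IsKernel k) {f : X → ℝ} {c : ℝ} (hc : 0 < c)
    (h : IsKernel fun x y => k x y - c * (f x * f y)) : ∃ g : RKHSpace hk, ⇑g = f := by
  -- Positivity of `k - c f ⊗ f` reads `c (∑ aᵢ f xᵢ)² ≤ ‖∑ aᵢ k(·, xᵢ)‖²`, whence the constant
  -- `c^(-1/2)`.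
  obtain ⟨w, -, hw⟩ := exists_inner_eq_of_abs_sum_le (kernelSection hk) f
    (C := √c⁻¹) (by positivity) fun n x a => by
      rw [← Real.sqrt_sq (norm_nonneg (∑ i, a i • kernelSection hk (x i))),
        ← Real.sqrt_mul (by positivity)]
      refine Real.abs_le_sqrt ?_
      rw [norm_sum_kernelSection_sq, inv_mul_eq_div, le_div_iff₀ hc]
      have h1 := h.2 n x a
      have h2 : ∑ i, ∑ j, a i * (k (x i) (x j) - c * (f (x i) * f (x j))) * a j =
          ∑ i, ∑ j, a i * k (x i) (x j) * a j - (∑ i, a i * f (x i)) ^ 2 * c := by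
        rw [pow_two, Finset.sum_mul_sum, Finset.sum_mul, ← Finset.sum_sub_distrib]
        refine Finset.sum_congr rfl fun i _ => ?_
        rw [Finset.sum_mul, ← Finset.sum_sub_distrib]
        exact Finset.sum_congr rfl fun j _ => by ring
      linarith
  exact ⟨w, funext fun x => by rw [← inner_kernelSection, hw]⟩

/-- Functions in the reproducing kernel Hilbert space of a kernel with feature map `Φ ∘ i` extend
along the feature map, without increase of the norm, to functions in the reproducing kernel
Hilbert space of `Φ ∘ j`. -/
theorem exists_transfer {Y : Type*} {kY : Y → Y → ℝ} (hkY : IsKernel kY) (i j : X → Y)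
    (hk : IsKernel fun p p' => kY (i p) (i p')) (hkt : IsKernel fun p p' => kY (j p) (j p'))
    (h : RKHSpace hk) : ∃ ht : RKHSpace hkt, ∀ p, |h p - ht p| ≤
      √(kY (i p) (i p) - 2 * kY (i p) (j p) + kY (j p) (j p)) * ‖h‖ := by
  let Φ := kernelSection hkY
  -- Kernel sections of a pulled-back kernel and the features `Φ ∘ s` have the same Gram matrix, so
  -- bounds pass between the two spaces.
  have key : ∀ (s : X → Y) (hs : IsKernel fun p p' => kY (s p) (s p')) (n : ℕ) (x : Fin n → X)
      (a : Fin n → ℝ), ‖∑ m, a m • kernelSection hs (x m)‖ = ‖∑ m, a m • Φ (s (x m))‖ := by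
    intro s hs n x a
    rw [← sq_eq_sq₀ (norm_nonneg _) (norm_nonneg _), norm_sum_kernelSection_sq,
      norm_sum_kernelSection_sq hkY (fun m => s (x m))]
  obtain ⟨w, hwn, hw⟩ := exists_inner_eq_of_abs_sum_le (fun p => Φ (i p)) (fun p => h p)
    (norm_nonneg h) fun n x a => by
      rw [← key i hk]
      simpa only [inner_kernelSection] using abs_sum_mul_inner_le h (kernelSection hk) x a
  obtain ⟨ht, -, hht⟩ := exists_inner_eq_of_abs_sum_le (kernelSection hkt)
    (fun p => ⟪w, Φ (j p)⟫_ℝ) (norm_nonneg w) fun n x a => by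
      rw [key j hkt]
      exact abs_sum_mul_inner_le w (fun p => Φ (j p)) x a
  refine ⟨ht, fun p => ?_⟩
  have h1 : h p - ht p = ⟪w, Φ (i p) - Φ (j p)⟫_ℝ := by
    rw [inner_sub_right, hw, ← hht, inner_kernelSection]
  have h2 : ‖Φ (i p) - Φ (j p)‖ ^ 2 =
      kY (i p) (i p) - 2 * kY (i p) (j p) + kY (j p) (j p) := by
    rw [norm_sub_sq_real, ← real_inner_self_eq_norm_sq, ← real_inner_self_eq_norm_sq]
    simp only [Φ, inner_kernelSection_kernelSection]
  rw [h1, ← h2, Real.sqrt_sq (norm_nonneg _), mul_comm]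
  exact (abs_real_inner_le_norm _ _).trans (by gcongr)

end Membership

/-! ### Least-norm approximation -/

section LeastNorm

variable {X : Type*} [TopologicalSpace X] {k : X → X → ℝ}

/-- Point evaluations are continuous, so the feasible set is closed; it is convex, so the projection
theorem gives a point nearest to `0`. -/
theorem existsUnique_isLeastNormApprox (hk : IsKernel k) (ε : ℝ) (f : C(X, ℝ))
    (hne : ∃ g : RKHSpace hk, ∀ p, |g p - f p| ≤ ε) :
    ∃! h : RKHSpace hk, IsLeastNormApprox hk ε f h := by
  have : Fact (kernelMatrix k).PosSemidef := ⟨hk.posSemidef⟩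
  let S : Set (RKHSpace hk) := {g | ∀ p, |g p - f p| ≤ ε}
  have hcl : IsClosed S := by
    simp only [S, Set.ofPred_forall]
    refine isClosed_iInter fun p => isClosed_le ?_ continuous_const
    exact ((RKHS.continuous_eval p).sub continuous_const).abs
  have hconv : Convex ℝ S := by
    intro g hg h hh a b ha hb hab p
    have e : (a • g + b • h : RKHSpace hk) p - f p = a * (g p - f p) + b * (h p - f p) := by
      rw [RKHS.coe_add, RKHS.coe_smul, RKHS.coe_smul]
      simp only [Pi.add_apply, Pi.smul_apply, smul_eq_mul]
      linear_combination f p * hab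
    rw [e]
    calc |a * (g p - f p) + b * (h p - f p)| ≤ |a * (g p - f p)| + |b * (h p - f p)| :=
          abs_add_le _ _
      _ = a * |g p - f p| + b * |h p - f p| := by
          rw [abs_mul, abs_mul, abs_of_nonneg ha, abs_of_nonneg hb]
      _ ≤ a * ε + b * ε := by gcongr; exacts [hg p, hh p]
      _ = ε := by rw [← add_mul, hab, one_mul]
  obtain ⟨h, hS, hmin⟩ :=
    exists_norm_eq_iInf_of_complete_convex (K := S) hne hcl.isComplete hconv 0
  have hle : ∀ g ∈ S, ‖h‖ ≤ ‖g‖ := by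
    intro g hg
    have h1 := ciInf_le (f := fun w : S => ‖(0 : RKHSpace hk) - w‖)
      ⟨0, Set.forall_mem_range.2 fun _ => norm_nonneg _⟩ ⟨g, hg⟩
    rw [← hmin] at h1
    simpa using h1
  refine ⟨h, ⟨hS, fun g hg => by gcongr; exact hle g hg⟩, fun g hg => ?_⟩
  have hgh : ‖g‖ = ‖h‖ := le_antisymm
    ((sq_le_sq₀ (norm_nonneg _) (norm_nonneg _)).mp (hg.2 h hS)) (hle g hg.1)
  -- The midpoint of two minimisers is feasible, so the parallelogram law forces them to coincide.
  have hmid := hle _ (hconv hg.1 hS (by norm_num : (0 : ℝ) ≤ 1 / 2)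
    (by norm_num : (0 : ℝ) ≤ 1 / 2) (by norm_num))
  rw [← smul_add, norm_smul, Real.norm_of_nonneg (by norm_num)] at hmid
  have hpar := parallelogram_law_with_norm ℝ g h
  rw [hgh] at hpar
  have : ‖g - h‖ * ‖g - h‖ ≤ 0 := by nlinarith [norm_nonneg h, norm_nonneg (g + h)]
  have : ‖g - h‖ = 0 := by nlinarith [norm_nonneg (g - h)]
  exact sub_eq_zero.mp (norm_eq_zero.mp this)

end LeastNorm

/-! ### Power series kernels and Gaussian mixtures -/

section PowerSeries

variable {X : Type*} {E : Type*} [NormedAddCommGroup E] [InnerProductSpace ℝ E]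

theorem isKernel_of_hasSum_pow {k l : X → X → ℝ} (hl : IsKernel l) {a : ℕ → ℝ}
    (ha : ∀ n, 0 ≤ a n) (h : ∀ x y, HasSum (fun n => a n * l x y ^ n) (k x y)) : IsKernel k :=
  IsKernel.of_hasSum (fun n => (hl.pow n).const_mul (ha n)) h

/-- Only the term of index `m` is altered; every term remains a kernel. -/
theorem isKernel_sub_of_hasSum_pow {k l : X → X → ℝ} (hl : IsKernel l) {a : ℕ → ℝ}
    (ha : ∀ n, 0 ≤ a n) (h : ∀ x y, HasSum (fun n => a n * l x y ^ n) (k x y)) {m : ℕ}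
    {f : X → ℝ} (hf : IsKernel fun x y => l x y ^ m - f x * f y) :
    IsKernel fun x y => k x y - a m * (f x * f y) := by
  refine IsKernel.of_hasSum
    (g := fun n x y => a n * l x y ^ n - if n = m then a m * (f x * f y) else 0) (fun n => ?_)
    fun x y => (h x y).sub (hasSum_ite_eq m _)
  by_cases hn : n = m
  · subst hn
    simpa only [if_true, mul_sub] using hf.const_mul (ha n)
  · simpa only [hn, if_false, sub_zero] using (hl.pow n).const_mul (ha n)

theorem hasSum_exp_pow (s t : ℝ) :
    HasSum (fun n : ℕ => s ^ n / n.factorial * t ^ n) (Real.exp (s * t)) := by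
  have h := NormedSpace.exp_series_hasSum_exp' (𝕂 := ℝ) (s * t)
  rw [← Real.exp_eq_exp_ℝ] at h
  refine h.congr_fun fun n => ?_
  rw [smul_eq_mul, mul_pow]
  ring

theorem exp_neg_mul_norm_sub_sq (s : ℝ) (u v : E) :
    Real.exp (-s * ‖u - v‖ ^ 2) = Real.exp (-s * ‖u‖ ^ 2) * Real.exp (-s * ‖v‖ ^ 2) *
      Real.exp (2 * s * ⟪u, v⟫_ℝ) := by
  rw [← Real.exp_add, ← Real.exp_add, norm_sub_sq_real]
  congr 1
  ring

theorem isKernel_gaussian (Φ : X → E) {s : ℝ} (hs : 0 ≤ s) :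
    IsKernel fun x y => Real.exp (-s * ‖Φ x - Φ y‖ ^ 2) := by
  simp only [exp_neg_mul_norm_sub_sq]
  exact (isKernel_mul_self fun x => Real.exp (-s * ‖Φ x‖ ^ 2)).mul
    (isKernel_of_hasSum_pow (isKernel_inner Φ) (fun n => by positivity)
      fun x y => hasSum_exp_pow (2 * s) _)

/-- Lowering the coefficient from `s` to `s₀` makes it independent of `s`, so that it can leave an
integral over `s ≥ s₀`. -/
theorem isKernel_gaussian_sub (Φ : X → E) {s s₀ : ℝ} (hs₀ : 0 ≤ s₀) (hs : s₀ ≤ s) {m : ℕ}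
    {f : X → ℝ} (hf : IsKernel fun x y => ⟪Φ x, Φ y⟫_ℝ ^ m - f x * f y) :
    IsKernel fun x y => Real.exp (-s * ‖Φ x - Φ y‖ ^ 2) - (2 * s₀) ^ m / m.factorial *
      ((Real.exp (-s * ‖Φ x‖ ^ 2) * Real.exp (-s * ‖Φ y‖ ^ 2)) * (f x * f y)) := by
  have h1 := (isKernel_mul_self fun x => Real.exp (-s * ‖Φ x‖ ^ 2)).mul
    (isKernel_sub_of_hasSum_pow (isKernel_inner Φ)
      (a := fun n : ℕ => (2 * s) ^ n / n.factorial)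
      (fun n => by have := hs₀.trans hs; positivity) (fun x y => hasSum_exp_pow (2 * s) _) hf)
  have h2 : 0 ≤ (2 * s) ^ m / m.factorial - (2 * s₀) ^ m / m.factorial := by
    rw [sub_nonneg]
    gcongr
  have h3 := h1.add (((isKernel_mul_self fun x => Real.exp (-s * ‖Φ x‖ ^ 2)).mul
    (isKernel_mul_self f)).const_mul h2)
  convert h3 using 3 with x y
  rw [exp_neg_mul_norm_sub_sq]
  ring

end PowerSeries

section Mixture

open MeasureTheory

variable {X : Type*} {E : Type*} [NormedAddCommGroup E] [InnerProductSpace ℝ E]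

theorem isKernel_integral {S : Type*} [MeasurableSpace S] (ν : Measure S) {g : S → X → X → ℝ}
    (hg : ∀ s, IsKernel (g s)) (hi : ∀ x y, Integrable (fun s => g s x y) ν) :
    IsKernel fun x y => ∫ s, g s x y ∂ν := by
  refine ⟨fun x y => by simp only [(hg _).1 x y], fun n x a => ?_⟩
  have h : ∑ i, ∑ j, a i * (∫ s, g s (x i) (x j) ∂ν) * a j =
      ∫ s, ∑ i, ∑ j, a i * g s (x i) (x j) * a j ∂ν := by
    rw [integral_finsetSum _ fun i _ => integrable_finsetSum _ fun j _ =>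
      ((hi _ _).const_mul _).mul_const _]
    refine Finset.sum_congr rfl fun i _ => ?_
    rw [integral_finsetSum _ fun j _ => ((hi _ _).const_mul _).mul_const _]
    exact Finset.sum_congr rfl fun j _ => by rw [integral_mul_const, integral_const_mul]
  rw [h]
  exact integral_nonneg fun s => (hg s).2 n x a

/-- A covariance: it equals the integral of the product of the deviations of `e s x` and `e s y`
from their means `w`. -/
theorem isKernel_integral_mul_sub {S : Type*} [MeasurableSpace S] (ν : Measure S)
    [IsFiniteMeasure ν] {e : S → X → ℝ} (hi : ∀ x, Integrable (fun s => e s x) ν)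
    (hi2 : ∀ x y, Integrable (fun s => e s x * e s y) ν) :
    IsKernel fun x y => (∫ s, e s x * e s y ∂ν) -
      (ν.real Set.univ)⁻¹ * ((∫ s, e s x ∂ν) * ∫ s, e s y ∂ν) := by
  -- For total mass `0` the convention `0⁻¹ = 0` removes the subtracted term.
  rcases eq_or_ne (ν.real Set.univ) 0 with h0 | h0
  · simpa only [h0, inv_zero, zero_mul, sub_zero] using
      isKernel_integral ν (fun s => isKernel_mul_self (e s)) hi2
  let w : X → ℝ := fun x => (ν.real Set.univ)⁻¹ * ∫ s, e s x ∂ν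
  have key := isKernel_integral ν (g := fun s x y => (e s x - w x) * (e s y - w y))
    (fun s => isKernel_mul_self fun x => e s x - w x) fun x y => by
      have := (((hi2 x y).sub ((hi x).mul_const (w y))).sub ((hi y).const_mul (w x))).add
        (integrable_const (w x * w y))
      refine this.congr (.of_forall fun s => ?_)
      simp only [Pi.add_apply, Pi.sub_apply]
      ring
  convert key using 3 with x y
  have h1 : ∀ s, (e s x - w x) * (e s y - w y) =
      e s x * e s y - e s x * w y - w x * e s y + w x * w y := fun s => by ring
  simp only [h1]
  have i1 : Integrable (fun s => e s x * e s y - e s x * w y) ν :=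
    (hi2 x y).sub ((hi x).mul_const _)
  have i2 : Integrable (fun s => e s x * e s y - e s x * w y - w x * e s y) ν :=
    i1.sub ((hi y).const_mul _)
  rw [integral_add i2 (integrable_const _), integral_sub i1 ((hi y).const_mul _),
    integral_sub (hi2 x y) ((hi x).mul_const _),
    integral_mul_const, integral_const_mul, integral_const, smul_eq_mul]
  simp only [w]
  field_simp
  ring

variable (μ : Measure ℝ≥0) [IsFiniteMeasure μ]

theorem integrable_exp_neg_mul {t : ℝ} (ht : 0 ≤ t) :
    Integrable (fun s : ℝ≥0 => Real.exp (-(s : ℝ) * t)) μ := by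
  refine (integrable_const (1 : ℝ)).mono' (by fun_prop) (.of_forall fun s => ?_)
  rw [Real.norm_of_nonneg (Real.exp_pos _).le, Real.exp_le_one_iff]
  nlinarith [s.coe_nonneg]

theorem isKernel_radialFun (Φ : X → E) :
    IsKernel fun x y => radialFun μ (‖Φ x - Φ y‖ ^ 2) :=
  isKernel_integral μ (fun s => isKernel_gaussian Φ s.coe_nonneg)
    fun _ _ => integrable_exp_neg_mul μ (sq_nonneg _)

/-- For `s ≥ s₀` a rank-one multiple is split off each Gaussian; other `s` keep theirs. The
covariance lemma then replaces the integral of a product by a product of integrals, which has rank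
one. -/
theorem isKernel_radialFun_sub (Φ : X → E) (s₀ : ℝ≥0) {m : ℕ}
    {f : X → ℝ} (hf : IsKernel fun x y => ⟪Φ x, Φ y⟫_ℝ ^ m - f x * f y) :
    IsKernel fun x y => radialFun μ (‖Φ x - Φ y‖ ^ 2) -
      (2 * (s₀ : ℝ)) ^ m / m.factorial * ((μ.restrict (Set.Ici s₀)).real Set.univ)⁻¹ *
      ((radialFun (μ.restrict (Set.Ici s₀)) (‖Φ x‖ ^ 2) * f x) *
        (radialFun (μ.restrict (Set.Ici s₀)) (‖Φ y‖ ^ 2) * f y)) := by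
  set S := Set.Ici s₀
  set b : ℝ := (2 * (s₀ : ℝ)) ^ m / m.factorial
  have hb : 0 ≤ b := by positivity
  have hS : MeasurableSet S := measurableSet_Ici
  let e : ℝ≥0 → X → ℝ := fun s x => Real.exp (-(s : ℝ) * ‖Φ x‖ ^ 2)
  have he2 : ∀ (ν : Measure ℝ≥0) [IsFiniteMeasure ν] (x y : X),
      Integrable (fun s => e s x * e s y) ν := by
    intro ν _ x y
    refine (integrable_exp_neg_mul ν (t := ‖Φ x‖ ^ 2 + ‖Φ y‖ ^ 2) (by positivity)).congr
      (.of_forall fun s => ?_)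
    simp only [e, ← Real.exp_add, mul_add]
  have h1 := isKernel_integral μ (g := fun s x y => Real.exp (-(s : ℝ) * ‖Φ x - Φ y‖ ^ 2) -
      S.indicator (fun s => b * (e s x * e s y * (f x * f y))) s)
    (fun s => by
      by_cases hs : s ∈ S
      · simpa only [Set.indicator_of_mem hs] using
          isKernel_gaussian_sub Φ s₀.coe_nonneg (NNReal.coe_le_coe.mpr hs) hf
      · simpa only [Set.indicator_of_notMem hs, sub_zero] using
          isKernel_gaussian Φ s.coe_nonneg)
    fun x y => (integrable_exp_neg_mul μ (sq_nonneg _)).sub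
      (((he2 μ x y).mul_const _).const_mul _ |>.indicator hS)
  have h2 := ((isKernel_integral_mul_sub (μ.restrict S) (e := e)
    (fun x => integrable_exp_neg_mul _ (sq_nonneg _)) (he2 _)).mul
      (isKernel_mul_self f)).const_mul hb
  convert h1.add h2 using 3 with x y
  rw [integral_sub (integrable_exp_neg_mul μ (sq_nonneg _))
    (((he2 μ x y).mul_const _).const_mul _ |>.indicator hS), integral_indicator hS,
    integral_const_mul, integral_mul_const]
  simp only [radialFun, e]
  ring

theorem radialFun_pos {μ : Measure ℝ≥0} [IsFiniteMeasure μ] (hμ : μ ≠ 0) {t : ℝ} (ht : 0 ≤ t) :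
    0 < radialFun μ t := by
  have : NeZero μ := ⟨hμ⟩
  exact integral_exp_pos (integrable_exp_neg_mul μ ht)

theorem continuousOn_radialFun : ContinuousOn (radialFun μ) (Set.Ici 0) := by
  refine continuousOn_of_dominated (bound := fun _ => (1 : ℝ)) (fun t _ => by fun_prop)
    (fun t ht => .of_forall fun s => ?_) (integrable_const _)
    (.of_forall fun s => by fun_prop)
  rw [Real.norm_of_nonneg (Real.exp_pos _).le, Real.exp_le_one_iff]
  nlinarith [s.coe_nonneg, Set.mem_Ici.mp ht]

/-- A support point `s ≠ 0` has the neighbourhood `[s/2, ∞)`, of positive mass. Having `s₀ > 0`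
keeps the coefficients `(2 s₀) ^ m / m!` positive. -/
theorem exists_restrict_Ici_ne_zero {μ : Measure ℝ≥0} (hμ : μ ≠ 0) (hs : μ.support ≠ {0}) :
    ∃ s₀ : ℝ≥0, 0 < s₀ ∧ μ.restrict (Set.Ici s₀) ≠ 0 := by
  obtain ⟨s, hs, hs0⟩ : ∃ s ∈ μ.support, s ≠ 0 := by
    by_contra! h
    exact hs ((Measure.nonempty_support hμ).subset_singleton_iff.mp h)
  have hpos : 0 < s := pos_iff_ne_zero.mpr hs0
  refine ⟨s / 2, half_pos hpos, ?_⟩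
  rw [Ne, Measure.restrict_eq_zero]
  exact ((Measure.mem_support_iff_forall s).mp hs _ (Ici_mem_nhds (half_lt_self hpos))).ne'

end Mixture

/-! ### Monomials and density -/

section Density

variable {X : Type*}

/-- One coordinate of `∑ aⱼ Φ(xⱼ)` is at most its norm. -/
theorem isKernel_inner_sub_coord (Φ : X → ℓ²(ℕ, ℝ)) (i : ℕ) :
    IsKernel fun x y => ⟪Φ x, Φ y⟫_ℝ - Φ x i * Φ y i := by
  refine ⟨fun x y => by simp only [real_inner_comm (Φ x), mul_comm], fun n x a => ?_⟩
  have h1 : ∑ j, ∑ l, a j * (⟪Φ (x j), Φ (x l)⟫_ℝ - Φ (x j) i * Φ (x l) i) * a l =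
      ‖∑ j, a j • Φ (x j)‖ ^ 2 - (∑ j, a j * Φ (x j) i) ^ 2 := by
    rw [← sum_sum_inner, pow_two, Finset.sum_mul_sum, ← Finset.sum_sub_distrib]
    refine Finset.sum_congr rfl fun j _ => ?_
    rw [← Finset.sum_sub_distrib]
    exact Finset.sum_congr rfl fun l _ => by ring
  have h2 : ∑ j, a j * Φ (x j) i = (∑ j, a j • Φ (x j)) i := by
    rw [lp.coeFn_sum]
    exact (Finset.sum_apply i Finset.univ fun j => ⇑(a j • Φ (x j))).symm
  rw [h1, h2, sub_nonneg, ← sq_abs]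
  gcongr
  rw [← Real.norm_eq_abs]
  exact lp.norm_apply_le_norm two_ne_zero _ i

variable [TopologicalSpace X]

theorem exists_isKernel_inner_pow_sub {Φ : X → ℓ²(ℕ, ℝ)} {c : ℕ → C(X, ℝ)}
    (hc : ∀ i x, c i x = Φ x i) {f : C(X, ℝ)} (hf : f ∈ Submonoid.closure (Set.range c)) :
    ∃ m, IsKernel fun x y => ⟪Φ x, Φ y⟫_ℝ ^ m - f x * f y := by
  induction hf using Submonoid.closure_induction with
  | mem f hf =>
    obtain ⟨i, rfl⟩ := hf
    exact ⟨1, by simpa only [pow_one, hc] using isKernel_inner_sub_coord Φ i⟩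
  | one => exact ⟨0, by simpa using isKernel_mul_self fun _ : X => (0 : ℝ)⟩
  | mul f g _ _ hf hg =>
    obtain ⟨m, hm⟩ := hf
    obtain ⟨n, hn⟩ := hg
    refine ⟨m + n, ?_⟩
    -- With `F = f ⊗ f`, `G = g ⊗ g` and `L` the inner product kernel: `L^(m+n) - F G = (L^m - F)
    -- L^n + F (L^n - G)`.
    convert (hm.mul ((isKernel_inner Φ).pow n)).add ((isKernel_mul_self f).mul hn) using 3 with x y
    simp only [pow_add, ContinuousMap.mul_apply]
    ring

theorem exists_near_of_monomials [CompactSpace X] {k : X → X → ℝ} (hk : IsKernel k)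
    {s : Set C(X, ℝ)} (hs : ∀ x y, x ≠ y → ∃ c ∈ s, c x ≠ c y) (w : C(X, ℝ))
    (hw : ∀ x, 0 < w x)
    (hmem : ∀ f ∈ Submonoid.closure s, ∃ g : RKHSpace hk, ∀ x, g x = w x * f x)
    {ε : ℝ} (hε : 0 < ε) (f : C(X, ℝ)) : ∃ g : RKHSpace hk, ∀ x, |g x - f x| ≤ ε := by
  have : Fact (kernelMatrix k).PosSemidef := ⟨hk.posSemidef⟩
  have hadj : ∀ p ∈ Algebra.adjoin ℝ s, ∃ g : RKHSpace hk, ∀ x, g x = w x * p x := by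
    intro p hp
    rw [← Subalgebra.mem_toSubmodule, Algebra.adjoin_eq_span] at hp
    induction hp using Submodule.span_induction with
    | mem p hp => exact hmem p hp
    | zero => exact ⟨0, fun x => by simp [RKHS.coe_zero]⟩
    | add p p' _ _ h h' =>
      obtain ⟨g, hg⟩ := h
      obtain ⟨g', hg'⟩ := h'
      exact ⟨g + g', fun x => by
        rw [RKHS.coe_add, Pi.add_apply, hg, hg', ContinuousMap.add_apply, mul_add]⟩
    | smul r p _ h =>
      obtain ⟨g, hg⟩ := h
      exact ⟨r • g, fun x => by
        rw [RKHS.coe_smul, Pi.smul_apply, hg, ContinuousMap.smul_apply, smul_eq_mul, smul_eq_mul]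
        ring⟩
  have hsep : (Algebra.adjoin ℝ s).SeparatesPoints := by
    intro x y hxy
    obtain ⟨c, hc, hne⟩ := hs x y hxy
    exact ⟨c, ⟨c, Algebra.subset_adjoin hc, rfl⟩, hne⟩
  -- Stone–Weierstrass approximates `f / w`; multiplying back by `w` costs at most `‖w‖`. The added
  -- `1` keeps the denominator positive.
  obtain ⟨⟨p, hp⟩, hnear⟩ := ContinuousMap.exists_mem_subalgebra_near_continuous_of_separatesPoints
    _ hsep (fun x => f x / w x) (f.continuous.div w.continuous fun x => (hw x).ne')
    (ε / (‖w‖ + 1)) (by positivity)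
  obtain ⟨g, hg⟩ := hadj p hp
  refine ⟨g, fun x => ?_⟩
  have h1 : g x - f x = w x * (p x - f x / w x) := by
    rw [hg, mul_sub, mul_div_cancel₀ _ (hw x).ne']
  have h2 : |w x| ≤ ‖w‖ + 1 := (w.norm_coe_le_norm x).trans (by linarith)
  rw [h1, abs_mul]
  calc |w x| * |p x - f x / w x| ≤ (‖w‖ + 1) * (ε / (‖w‖ + 1)) := by
        gcongr
        exact (hnear x).le
    _ = ε := mul_div_cancel₀ _ (by positivity)

end Density

/-! ### The embedding and its truncation -/

section Geometry

variable {X : Type*} [MetricSpace X] (x : ℕ → X) {q : ℝ} (hq : 1 < q)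

theorem cPhi_pos {q : ℝ} (hq : 1 < q) : 0 < cPhi q :=
  div_pos (Real.sqrt_pos.mpr (by nlinarith)) (by linarith)

theorem cPhi_sq {q : ℝ} (hq : 1 < q) : cPhi q ^ 2 = 1 - (q ^ 2)⁻¹ := by
  have : q ≠ 0 := by linarith
  rw [cPhi, div_pow, Real.sq_sqrt (by nlinarith)]
  field_simp

/-- The coordinates of `φ` as continuous functions. -/
noncomputable def phiCoord (q : ℝ) (n : ℕ) : C(X, ℝ) :=
  ⟨fun p => cPhi q * dist p (x n) / q ^ n, by fun_prop⟩

theorem exists_phiCoord_ne (hx : DenseRange x) {q : ℝ} (hq : 1 < q) {p p' : X} (h : p ≠ p') :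
    ∃ c ∈ Set.range (phiCoord x q), c p ≠ c p' := by
  obtain ⟨n, hn⟩ := hx.exists_dist_lt p (half_pos (dist_pos.mpr h))
  refine ⟨_, ⟨n, rfl⟩, fun he => ?_⟩
  have hq0 : 0 < q := by linarith
  have hc := (cPhi_pos hq).ne'
  have hd : dist p (x n) = dist p' (x n) := by
    simpa [phiCoord, hc, hq0.ne', div_left_inj'] using he
  have := dist_triangle_right p p' (x n)
  linarith

variable [CompactSpace X]

theorem dist_le_diamX (p p' : X) : dist p p' ≤ diamX X :=
  Metric.dist_le_diam_of_mem isCompact_univ.isBounded (Set.mem_univ _) (Set.mem_univ _)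

theorem diamX_pos [Nontrivial X] : 0 < diamX X := by
  obtain ⟨p, p', h⟩ := exists_pair_ne X
  exact (dist_pos.mpr h).trans_le (dist_le_diamX p p')

theorem pad_phiTrunc_apply (N : ℕ) (p : X) (n : ℕ) :
    pad (phiTrunc x q N p) n = if n < N then phi x hq p n else 0 := by
  change (if h : n < N then _ else _) = _
  split_ifs <;> rfl

/-- The tail is dominated by a geometric series of ratio `q⁻²`, whose factor `(1 - q⁻²)⁻¹` is
cancelled by `c² = 1 - q⁻²`. -/
theorem norm_phi_sub_pad_sq_le (N : ℕ) (p : X) :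
    ‖phi x hq p - pad (phiTrunc x q N p)‖ ^ 2 ≤ (diamX X * (q ^ N)⁻¹) ^ 2 := by
  have hq0 : 0 < q := by linarith
  set z := phi x hq p - pad (phiTrunc x q N p)
  set r : ℝ := (q ^ 2)⁻¹
  have hr1 : r < 1 := inv_lt_one_of_one_lt₀ (one_lt_pow₀ hq two_ne_zero)
  have hr0 : 0 ≤ r := by positivity
  have hz : ∀ n, z n = if n < N then 0 else cPhi q * dist p (x n) / q ^ n := by
    intro n
    rw [lp.coeFn_sub, Pi.sub_apply, pad_phiTrunc_apply x hq]
    split_ifs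
    · exact sub_self _
    · exact sub_zero _
  have hsum : HasSum (fun n => if n < N then 0 else (cPhi q * diamX X) ^ 2 * r ^ n)
      ((diamX X * (q ^ N)⁻¹) ^ 2) := by
    have h1 := (hasSum_geometric_of_lt_one hr0 hr1).mul_left ((cPhi q * diamX X) ^ 2 * r ^ N)
    have h2 : (cPhi q * diamX X) ^ 2 * r ^ N * (1 - r)⁻¹ = (diamX X * (q ^ N)⁻¹) ^ 2 := by
      have : 1 - r ≠ 0 := by linarith
      have hrN : r ^ N = ((q ^ N)⁻¹) ^ 2 := by
        simp only [r, inv_pow, ← pow_mul, mul_comm]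
      rw [mul_pow, cPhi_sq hq, mul_pow, ← hrN]
      change (1 - r) * _ * r ^ N * (1 - r)⁻¹ = _ * r ^ N
      field_simp
    rw [h2] at h1
    have h3 : HasSum (fun n => if n + N < N then 0 else (cPhi q * diamX X) ^ 2 * r ^ (n + N))
        ((diamX X * (q ^ N)⁻¹) ^ 2) := by
      refine h1.congr_fun fun n => ?_
      rw [if_neg (by omega), pow_add]
      ring
    rw [hasSum_nat_add_iff
      (f := fun n => if n < N then 0 else (cPhi q * diamX X) ^ 2 * r ^ n)] at h3
    rwa [Finset.sum_eq_zero (fun n hn => if_pos (Finset.mem_range.mp hn)), add_zero] at h3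
  rw [← real_inner_self_eq_norm_sq]
  refine hasSum_le (fun n => ?_) (lp.hasSum_inner (𝕜 := ℝ) z z) hsum
  rw [hz, real_inner_self_eq_norm_sq, Real.norm_eq_abs, sq_abs]
  split_ifs
  · simp
  · have : (cPhi q * diamX X) ^ 2 * r ^ n = (cPhi q * diamX X / q ^ n) ^ 2 := by
      rw [div_pow, inv_pow, div_eq_mul_inv, ← pow_mul, ← pow_mul, mul_comm 2 n]
    rw [this]
    have := (cPhi_pos hq).le
    gcongr
    exact dist_le_diamX _ _

theorem norm_phi_le (p : X) : ‖phi x hq p‖ ≤ diamX X := by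
  have h := norm_phi_sub_pad_sq_le x hq 0 p
  have h0 : pad (phiTrunc x q 0 p) = 0 := lp.ext (funext fun n => by
    rw [pad_phiTrunc_apply x hq]; simp)
  rw [h0, sub_zero, pow_zero, inv_one, mul_one] at h
  exact (sq_le_sq₀ (norm_nonneg _) Metric.diam_nonneg).mp h

/-- Truncation is the orthogonal projection onto the first `N` coordinates. -/
theorem inner_phi_pad (N : ℕ) (p : X) :
    ⟪phi x hq p, pad (phiTrunc x q N p)⟫_ℝ = ‖pad (phiTrunc x q N p)‖ ^ 2 := by
  rw [← real_inner_self_eq_norm_sq, lp.inner_eq_tsum, lp.inner_eq_tsum]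
  refine tsum_congr fun n => ?_
  rw [pad_phiTrunc_apply x hq]
  split_ifs <;> simp

theorem norm_phi_sq_sub (N : ℕ) (p : X) :
    ‖phi x hq p‖ ^ 2 - ‖pad (phiTrunc x q N p)‖ ^ 2 =
      ‖phi x hq p - pad (phiTrunc x q N p)‖ ^ 2 := by
  rw [norm_sub_sq_real, inner_phi_pad]
  ring

theorem norm_le_of_mem_wSet {N : ℕ} {u : ℓ²(ℕ, ℝ)} (hu : u ∈ wSet x hq N) : ‖u‖ ≤ diamX X := by
  rcases hu with ⟨p, rfl⟩ | ⟨p, rfl⟩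
  · exact norm_phi_le x hq p
  · refine le_trans ?_ (norm_phi_le x hq p)
    rw [← sq_le_sq₀ (norm_nonneg _) (norm_nonneg _), ← sub_nonneg, norm_phi_sq_sub x hq]
    positivity

theorem inner_mem_Icc_of_mem_wSet {N : ℕ} {u v : ℓ²(ℕ, ℝ)} (hu : u ∈ wSet x hq N)
    (hv : v ∈ wSet x hq N) :
    ⟪u, v⟫_ℝ ∈ Set.Icc (-(4 * diamX X ^ 2)) (4 * diamX X ^ 2) := by
  have h : |⟪u, v⟫_ℝ| ≤ diamX X * diamX X :=
    (abs_real_inner_le_norm u v).trans (by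
      exact mul_le_mul (norm_le_of_mem_wSet x hq hu) (norm_le_of_mem_wSet x hq hv)
        (norm_nonneg _) Metric.diam_nonneg)
  exact abs_le.mp (h.trans (by nlinarith [sq_nonneg (diamX X)]))

theorem continuous_norm_phi_sq : Continuous fun p => ‖phi x hq p‖ ^ 2 := by
  have h : ∀ p, ‖phi x hq p‖ ^ 2 = ∑' n, phiCoord x q n p ^ 2 := by
    intro p
    rw [← real_inner_self_eq_norm_sq, lp.inner_eq_tsum]
    refine tsum_congr fun n => ?_
    rw [real_inner_self_eq_norm_sq, Real.norm_eq_abs, sq_abs]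
    rfl
  simp only [h]
  have hq0 : 0 < q := by linarith
  refine continuous_tsum (u := fun n => (cPhi q * diamX X) ^ 2 * ((q ^ 2)⁻¹) ^ n)
    (fun n => by fun_prop) ((summable_geometric_of_lt_one (by positivity)
      (inv_lt_one_of_one_lt₀ (one_lt_pow₀ hq two_ne_zero))).mul_left _) fun n p => ?_
  have h2 : (cPhi q * diamX X) ^ 2 * ((q ^ 2)⁻¹) ^ n = (cPhi q * diamX X / q ^ n) ^ 2 := by
    rw [div_pow, inv_pow, div_eq_mul_inv, ← pow_mul, ← pow_mul, mul_comm 2 n]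
  have hc := (cPhi_pos hq).le
  rw [h2, Real.norm_of_nonneg (sq_nonneg _)]
  change (cPhi q * dist p (x n) / q ^ n) ^ 2 ≤ _
  gcongr
  exact dist_le_diamX _ _

end Geometry

/-! ### The Lipschitz estimate -/

theorem abs_sub_le_maxAbsDeriv {K : ℝ → ℝ} {a b : ℝ} (hab : a < b)
    (hK : ContDiffOn ℝ 1 K (Set.Icc a b)) {s t : ℝ} (hs : s ∈ Set.Icc a b)
    (ht : t ∈ Set.Icc a b) : |K t - K s| ≤ maxAbsDeriv K (Set.Icc a b) * |t - s| := by
  have hcont : ContinuousOn (fun t => |derivWithin K (Set.Icc a b) t|) (Set.Icc a b) :=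
    (hK.continuousOn_derivWithin (uniqueDiffOn_Icc hab) le_rfl).abs
  -- Boundedness matters: `sSup` of an unbounded set would be `0`.
  have hbdd := (isCompact_Icc.image_of_continuousOn hcont).bddAbove
  exact (convex_Icc a b).norm_image_sub_le_of_norm_derivWithin_le
    (hK.differentiableOn one_ne_zero) (fun t ht => le_csSup hbdd ⟨t, ht, rfl⟩) hs ht

theorem maxAbsDeriv_nonneg (K : ℝ → ℝ) (I : Set ℝ) : 0 ≤ maxAbsDeriv K I :=
  Real.sSup_nonneg (by rintro _ ⟨t, -, rfl⟩; exact abs_nonneg _)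

/-! ### The approximation property -/

section Approximation

variable {X : Type*} [MetricSpace X] [CompactSpace X] (x : ℕ → X) {q : ℝ} (hq : 1 < q) {N : ℕ}

theorem approximatesUpTo_of_kernel {kW : wSet x hq N → wSet x hq N → ℝ} (hkW : IsKernel kW)
    (hk : IsKernel (fullKernel x hq N kW)) (hkt : IsKernel (truncKernel x hq N kW)) {ρ : ℝ}
    (hdense : ∀ ε : ℝ, 0 < ε → ∀ f : C(X, ℝ), ∃ g : RKHSpace hk, ∀ p, |g p - f p| ≤ ε)
    (hρ : 0 ≤ ρ)
    (hle : ∀ p : X, ∀ (u v : wSet x hq N), (u : ℓ²(ℕ, ℝ)) = phi x hq p →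
      (v : ℓ²(ℕ, ℝ)) = pad (phiTrunc x q N p) → kW u u - 2 * kW u v + kW v v ≤ ρ ^ 2) :
    ApproximatesUpTo hk hkt ρ := by
  intro ε hε f
  refine ⟨existsUnique_isLeastNormApprox hk ε f (hdense ε hε f), fun h hh => ?_⟩
  obtain ⟨ht, hht⟩ := exists_transfer hkW (fun p => ⟨phi x hq p, Or.inl ⟨p, rfl⟩⟩)
    (fun p => ⟨pad (phiTrunc x q N p), Or.inr ⟨p, rfl⟩⟩) hk hkt h
  refine ⟨ht, fun p => ?_⟩
  have h1 := hht p
  have h2 := Real.sqrt_le_iff.mpr ⟨hρ, hle p ⟨phi x hq p, Or.inl ⟨p, rfl⟩⟩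
    ⟨pad (phiTrunc x q N p), Or.inr ⟨p, rfl⟩⟩ rfl rfl⟩
  have h3 := hh.1 p
  rw [abs_sub_comm] at h3
  calc |f p - ht p| ≤ |f p - h p| + |h p - ht p| := abs_sub_le _ _ _
    _ ≤ ε + ρ * ‖h‖ := add_le_add h3 (h1.trans (mul_le_mul_of_nonneg_right h2 (norm_nonneg _)))

theorem approximatesUpTo_taylor [Nontrivial X] (hx : DenseRange x) {a : ℕ → ℝ}
    (ha : IsTaylorCoeff a (4 * diamX X ^ 2))
    (hK : ContDiffOn ℝ 1 (taylorFun a) (Set.Icc (-(4 * diamX X ^ 2)) (4 * diamX X ^ 2))) :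
    ∃ (hk : IsKernel (fullKernel x hq N (taylorKernel a (wSet x hq N))))
      (hkt : IsKernel (truncKernel x hq N (taylorKernel a (wSet x hq N)))),
      ApproximatesUpTo hk hkt (q ^ (-(N : ℝ) / 2) * diamX X *
        √(2 * maxAbsDeriv (taylorFun a) (Set.Icc (-(4 * diamX X ^ 2)) (4 * diamX X ^ 2)))) := by
  have hq0 : 0 < q := by linarith
  have hD := diamX_pos (X := X)
  set I := Set.Icc (-(4 * diamX X ^ 2)) (4 * diamX X ^ 2)
  have hsum : ∀ u v : wSet x hq N,
      HasSum (fun n => a n * ⟪(u : ℓ²(ℕ, ℝ)), (v : ℓ²(ℕ, ℝ))⟫_ℝ ^ n)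
        (taylorKernel a (wSet x hq N) u v) := fun u v =>
    (summable_abs_iff.mp (ha.summable _ (inner_mem_Icc_of_mem_wSet x hq u.2 v.2))).hasSum
  have hkW : IsKernel (taylorKernel a (wSet x hq N)) :=
    isKernel_of_hasSum_pow (isKernel_inner fun u : wSet x hq N => (u : ℓ²(ℕ, ℝ)))
      (fun n => (ha.pos n).le) hsum
  have hk : IsKernel (fullKernel x hq N (taylorKernel a (wSet x hq N))) := hkW.comp _
  have hkt : IsKernel (truncKernel x hq N (taylorKernel a (wSet x hq N))) := hkW.comp _
  refine ⟨hk, hkt, approximatesUpTo_of_kernel x hq hkW hk hkt (fun ε hε f => ?_)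
    (by positivity) fun p u v hu hv => ?_⟩
  · refine exists_near_of_monomials hk (fun p p' h => exists_phiCoord_ne x hx hq h) 1
      (fun _ => one_pos) (fun m hm => ?_) hε f
    obtain ⟨n, hn⟩ := exists_isKernel_inner_pow_sub (Φ := phi x hq) (fun _ _ => rfl) hm
    obtain ⟨g, hg⟩ := exists_eq_of_isKernel_sub hk (ha.pos n)
      (isKernel_sub_of_hasSum_pow (isKernel_inner (phi x hq)) (fun n => (ha.pos n).le)
        (fun p p' => hsum ⟨phi x hq p, Or.inl ⟨p, rfl⟩⟩ ⟨phi x hq p', Or.inl ⟨p', rfl⟩⟩) hn)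
    exact ⟨g, fun p => by simp [hg]⟩
  -- Since `⟪u, v⟫ = ‖v‖²`, the feature distance squared collapses to `K(‖u‖²) - K(‖v‖²)`, and `‖u‖²
  -- - ‖v‖² = ‖u - v‖²`.
  · have huv : ⟪(u : ℓ²(ℕ, ℝ)), (v : ℓ²(ℕ, ℝ))⟫_ℝ = ⟪(v : ℓ²(ℕ, ℝ)), (v : ℓ²(ℕ, ℝ))⟫_ℝ := by
      rw [hu, hv, inner_phi_pad, real_inner_self_eq_norm_sq]
    have hdiff : ⟪(u : ℓ²(ℕ, ℝ)), (u : ℓ²(ℕ, ℝ))⟫_ℝ - ⟪(v : ℓ²(ℕ, ℝ)), (v : ℓ²(ℕ, ℝ))⟫_ℝ =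
        ‖phi x hq p - pad (phiTrunc x q N p)‖ ^ 2 := by
      rw [real_inner_self_eq_norm_sq, real_inner_self_eq_norm_sq, hu, hv, norm_phi_sq_sub]
    have hlip := abs_sub_le_maxAbsDeriv (by nlinarith) hK
      (inner_mem_Icc_of_mem_wSet x hq v.2 v.2) (inner_mem_Icc_of_mem_wSet x hq u.2 u.2)
    rw [hdiff, abs_of_nonneg (sq_nonneg ‖_‖)] at hlip
    have hM := maxAbsDeriv_nonneg (taylorFun a) I
    have hnorm := norm_phi_sub_pad_sq_le x hq N p
    have hpow : (q ^ (-(N : ℝ) / 2)) ^ 2 = (q ^ N)⁻¹ := by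
      rw [← Real.rpow_natCast, ← Real.rpow_mul hq0.le, ← Real.rpow_natCast, ← Real.rpow_neg hq0.le]
      congr 1
      push_cast
      ring
    have hinv : (q ^ N)⁻¹ ≤ 1 := inv_le_one_of_one_le₀ (one_le_pow₀ hq.le)
    have hinv0 : 0 ≤ (q ^ N)⁻¹ := by positivity
    rw [mul_pow, mul_pow, Real.sq_sqrt (by positivity), hpow]
    simp only [taylorKernel, huv]
    calc _ ≤ _ := by linarith [le_abs_self (taylorFun a ⟪(u : ℓ²(ℕ, ℝ)), (u : ℓ²(ℕ, ℝ))⟫_ℝ -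
          taylorFun a ⟪(v : ℓ²(ℕ, ℝ)), (v : ℓ²(ℕ, ℝ))⟫_ℝ)]
      _ ≤ maxAbsDeriv (taylorFun a) I * (diamX X * (q ^ N)⁻¹) ^ 2 := hlip.trans (by gcongr)
      _ = maxAbsDeriv (taylorFun a) I * diamX X ^ 2 * ((q ^ N)⁻¹ * (q ^ N)⁻¹) := by ring
      -- The bound so far has the rate `q^(-2N)`; the stated `2 q^(-N)` is weaker.
      _ ≤ maxAbsDeriv (taylorFun a) I * diamX X ^ 2 * (2 * (q ^ N)⁻¹) := by
          gcongr
          linarith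
      _ = _ := by ring

theorem approximatesUpTo_radial [Nontrivial X] (hx : DenseRange x)
    (μ : MeasureTheory.Measure ℝ≥0) [MeasureTheory.IsFiniteMeasure μ] (hμ : μ ≠ 0)
    (hs : μ.support ≠ {0}) (hK : ContDiffOn ℝ 1 (radialFun μ) (Set.Icc 0 (4 * diamX X ^ 2))) :
    ∃ (hk : IsKernel (fullKernel x hq N (radialKernel μ (wSet x hq N))))
      (hkt : IsKernel (truncKernel x hq N (radialKernel μ (wSet x hq N)))),
      ApproximatesUpTo hk hkt (q ^ (-(N : ℝ)) * diamX X *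
        √(2 * maxAbsDeriv (radialFun μ) (Set.Icc 0 (4 * diamX X ^ 2)))) := by
  have hq0 : 0 < q := by linarith
  have hD := diamX_pos (X := X)
  set I := Set.Icc 0 (4 * diamX X ^ 2)
  have hkW : IsKernel (radialKernel μ (wSet x hq N)) :=
    isKernel_radialFun μ fun u : wSet x hq N => (u : ℓ²(ℕ, ℝ))
  have hk : IsKernel (fullKernel x hq N (radialKernel μ (wSet x hq N))) := hkW.comp _
  have hkt : IsKernel (truncKernel x hq N (radialKernel μ (wSet x hq N))) := hkW.comp _
  refine ⟨hk, hkt, approximatesUpTo_of_kernel x hq hkW hk hkt (fun ε hε f => ?_)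
    (by positivity) fun p u v hu hv => ?_⟩
  · obtain ⟨s₀, hs₀, hne⟩ := exists_restrict_Ici_ne_zero hμ hs
    set ν := μ.restrict (Set.Ici s₀)
    have : NeZero ν := ⟨hne⟩
    let w : C(X, ℝ) := ⟨fun p => radialFun ν (‖phi x hq p‖ ^ 2),
      (continuousOn_radialFun ν).comp_continuous (continuous_norm_phi_sq x hq)
        fun _ => Set.mem_Ici.mpr (sq_nonneg _)⟩
    refine exists_near_of_monomials hk (fun p p' h => exists_phiCoord_ne x hx hq h) w
      (fun _ => radialFun_pos hne (sq_nonneg _)) (fun m hm => ?_) hε f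
    obtain ⟨n, hn⟩ := exists_isKernel_inner_pow_sub (Φ := phi x hq) (fun _ _ => rfl) hm
    have hν : 0 < ν.real Set.univ := MeasureTheory.measureReal_univ_pos
    have hs₀' : 0 < (s₀ : ℝ) := hs₀
    obtain ⟨g, hg⟩ := exists_eq_of_isKernel_sub hk (by positivity)
      (isKernel_radialFun_sub μ (phi x hq) s₀ hn)
    exact ⟨g, fun p => by rw [hg]; rfl⟩
  · have hnorm := norm_phi_sub_pad_sq_le x hq N p
    have hmem : ‖(u : ℓ²(ℕ, ℝ)) - v‖ ^ 2 ∈ I := by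
      refine ⟨sq_nonneg _, ?_⟩
      have h1 := norm_sub_le (u : ℓ²(ℕ, ℝ)) v
      have h2 := norm_le_of_mem_wSet x hq u.2
      have h3 := norm_le_of_mem_wSet x hq v.2
      calc ‖(u : ℓ²(ℕ, ℝ)) - v‖ ^ 2 ≤ (2 * diamX X) ^ 2 := by gcongr; linarith
        _ = _ := by ring
    -- The feature distance squared is `2 (K(0) - K(‖u - v‖²))`, so the comparison starts at the
    -- endpoint `0`.
    have hlip := abs_sub_le_maxAbsDeriv (by positivity) hK ⟨le_rfl, by positivity⟩ hmem
    rw [sub_zero, abs_of_nonneg hmem.1, abs_sub_comm] at hlip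
    have hM := maxAbsDeriv_nonneg (radialFun μ) I
    rw [mul_pow, mul_pow, Real.sq_sqrt (by positivity), Real.rpow_neg hq0.le, Real.rpow_natCast]
    simp only [radialKernel, sub_self, norm_zero, ne_eq, OfNat.ofNat_ne_zero, not_false_eq_true,
      zero_pow]
    rw [← hu, ← hv] at hnorm
    calc _ ≤ 2 * (maxAbsDeriv (radialFun μ) I * ‖(u : ℓ²(ℕ, ℝ)) - v‖ ^ 2) := by
          linarith [le_abs_self (radialFun μ 0 - radialFun μ (‖(u : ℓ²(ℕ, ℝ)) - v‖ ^ 2))]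
      _ ≤ 2 * (maxAbsDeriv (radialFun μ) I * (diamX X * (q ^ N)⁻¹) ^ 2) := by gcongr
      _ = _ := by ring

end Approximation

end TruncatedKernel

theorem mainTheorem3 {X : Type*} [MetricSpace X] [CompactSpace X] [Nontrivial X]
    (x : ℕ → X) (hx : DenseRange x) (q : ℝ) (hq : 1 < q) (N : ℕ) (hN : 2 ≤ N) :
    (∀ a : ℕ → ℝ, IsTaylorCoeff a (4 * diamX X ^ 2) →
      ContDiffOn ℝ 1 (taylorFun a) (Set.Icc (-(4 * diamX X ^ 2)) (4 * diamX X ^ 2)) →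
      ∃ (hk : IsKernel (fullKernel x hq N (taylorKernel a (wSet x hq N))))
        (hkt : IsKernel (truncKernel x hq N (taylorKernel a (wSet x hq N)))),
        ApproximatesUpTo hk hkt
          (q ^ (-(N : ℝ) / 2) * diamX X *
            √(2 * maxAbsDeriv (taylorFun a)
              (Set.Icc (-(4 * diamX X ^ 2)) (4 * diamX X ^ 2))))) ∧
    (∀ μ : MeasureTheory.Measure ℝ≥0, MeasureTheory.IsFiniteMeasure μ → μ ≠ 0 →
      μ.support ≠ {0} →
      ContDiffOn ℝ 1 (radialFun μ) (Set.Icc 0 (4 * diamX X ^ 2)) →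
      ∃ (hk : IsKernel (fullKernel x hq N (radialKernel μ (wSet x hq N))))
        (hkt : IsKernel (truncKernel x hq N (radialKernel μ (wSet x hq N)))),
        ApproximatesUpTo hk hkt
          (q ^ (-(N : ℝ)) * diamX X *
            √(2 * maxAbsDeriv (radialFun μ) (Set.Icc 0 (4 * diamX X ^ 2))))) :=
  ⟨fun _ ha hK => approximatesUpTo_taylor x hq hx ha hK,
    fun μ _ hμ hs hK => approximatesUpTo_radial x hq hx μ hμ hs hK⟩
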